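/- Let $H$ be a separable complex Hilbert space and $A_c:\mathcal D_c\subset H\to H$ a densely defined symmetric operator that is semibounded from below. Let $A:\mathcal D_{\max}\subset H\to H$ be its adjoint, equip $\mathcal D_{\max}$ with the inner product $(u,v)_A=(Au,Av)+(u,v)$, and let $\mathcal D_{\min}$ be the domain of the closure of $A_c$. Assume that the inclusion $\mathcal D_{\max}\hookrightarrow H$ is compact and that $\mathcal D_{\min}$ has finite positive codimension in $\mathcal D_{\max}$. Let $\mathcal E$ be the $(\cdot,\cdot)_A$-orthogonal complement of $\mathcal D_{\min}$ in $\mathcal D_{\max}$. Let $\mathcal D_F$ be the domain of the Friedrichs extension $A_F=A|_{\mathcal D_F}$ of $A_c$, i.e. the set of all $u\in\mathcal D_{\max}$ for which there are $x_n\in\mathcal D_c$ with $x_n\to u$ in $H$ and $(A_c(x_n-x_m),x_n-x_m)\to0$ as $n,m\to\infty$. Write $\mathcal D_F=D_F+\mathcal D_{\min}$ with $D_F=\mathcal D_F\cap\mathcal E$, and let $D_F^\perp$ be the $(\cdot,\cdot)_A$-orthogonal complement of $D_F$ in $\mathcal E$. For $u\in D_F^\perp$ let $\delta_u:\mathcal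 D_F\to\mathbb C$ be the functional $$\langle\delta_u,v\rangle=(Av,u)-(v,Au).$$ For $s\ge0$ let $\Pi_\lambda$ be the orthogonal projection on $\ker(A_F-\lambda)$ and $$H^s_{\mathcal D_F}=\Big\{u\in H:\ \sum_{\lambda\in\operatorname{spec}(A_F)}(1+|\lambda|)^{2s}\|\Pi_\lambda u\|^2<\infty\Big\},\qquad (u,v)_s=\sum_{\lambda\in\operatorname{spec}(A_F)}(1+|\lambda|)^{2s}(\Pi_\lambda u,\Pi_\lambda v),$$ and let $H^{-s}$ be the dual of $H^s_{\mathcal D_F}$; for $0\le s\le 1$ it is viewed, by restriction to $\mathcal D_F$, as a space of linear functionals on $\mathcal D_F$. Then $\mathcal D_c\subset\mathcal D_F\subset H^{1/2}_{\mathcal D_F}$, and $$\{\delta_u:u\in D_F^\perp\}\cap H^{-1/2}=\{0\};$$ more precisely, $\delta_u\notin H^{-1/2}$ for every $u\in D_F^\perp$ with $u\neq0$. Equivalently, the closure of $\mathcal D_c$ in $H^{1/2}_{\mathcal D_F}$ is all of $H^{1/2}_{\mathcal D_F}$. -/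

import Mathlib

open Filter Topology
open scoped LinearPMap

namespace FriedrichsRegularity

noncomputable section

variable {H : Type*} [NormedAddCommGroup H] [InnerProductSpace ℂ H]

/-! Mathlib's inner product is conjugate linear in the first slot, so the pairing `(x, y)` that is
linear in `x` is `inner ℂ y x`. -/

/-- The operator is symmetric and semibounded from below. -/
def IsSemiboundedBelow (Ac : H →ₗ.[ℂ] H) : Prop :=
  Ac.IsFormalAdjoint Ac ∧
    ∃ m : ℝ, ∀ x : Ac.domain, m * ‖(x : H)‖ ^ 2 ≤ (inner ℂ (x : H) (Ac x)).re

/-- The quadratic form `x ↦ (A_c x, x)` (its real part; the form is real when `A_c` is symmetric). -/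
def quadForm (Ac : H →ₗ.[ℂ] H) (x : Ac.domain) : ℝ := (inner ℂ (x : H) (Ac x)).re

/-- `x n ∈ D_c` converges to `u` in `H` and is Cauchy for the quadratic form. Since `x` also
converges in `H`, this is the same as being Cauchy for the shifted form
`(A_c x, x) + c (x, x)`, which is the square of a norm for large `c`. -/
def FormApprox (Ac : H →ₗ.[ℂ] H) (x : ℕ → Ac.domain) (u : H) : Prop :=
  Tendsto (fun n => (x n : H)) atTop (𝓝 u) ∧
    Tendsto (fun p : ℕ × ℕ => quadForm Ac (x p.1 - x p.2)) atTop (𝓝 0)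

theorem quadForm_add_tendsto {Ac : H →ₗ.[ℂ] H} (h : IsSemiboundedBelow Ac)
    {a b : ℕ × ℕ → Ac.domain}
    (ha : Tendsto (fun p => (a p : H)) atTop (𝓝 0)) (hb : Tendsto (fun p => (b p : H)) atTop (𝓝 0))
    (hqa : Tendsto (fun p => quadForm Ac (a p)) atTop (𝓝 0))
    (hqb : Tendsto (fun p => quadForm Ac (b p)) atTop (𝓝 0)) :
    Tendsto (fun p => quadForm Ac (a p + b p)) atTop (𝓝 0) := by
  obtain ⟨-, m, hm⟩ := h
  have hna : Tendsto (fun p => ‖(a p : H)‖ ^ 2) atTop (𝓝 0) := by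
    simpa using ha.norm.pow 2
  have hnb : Tendsto (fun p => ‖(b p : H)‖ ^ 2) atTop (𝓝 0) := by
    simpa using hb.norm.pow 2
  have hns : Tendsto (fun p => ‖((a p : H) + (b p : H))‖ ^ 2) atTop (𝓝 0) := by
    simpa using (ha.add hb).norm.pow 2
  have hnd : Tendsto (fun p => ‖((a p : H) - (b p : H))‖ ^ 2) atTop (𝓝 0) := by
    simpa using (ha.sub hb).norm.pow 2
  have par : ∀ p, quadForm Ac (a p + b p) + quadForm Ac (a p - b p)
      = 2 * quadForm Ac (a p) + 2 * quadForm Ac (b p) := by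
    intro p
    simp only [quadForm, LinearPMap.map_add, LinearPMap.map_sub, Submodule.coe_add,
      Submodule.coe_sub, inner_add_left, inner_add_right, inner_sub_left, inner_sub_right,
      Complex.add_re, Complex.sub_re]
    ring
  have hlow : Tendsto (fun p => m * ‖((a p : H) + (b p : H))‖ ^ 2) atTop (𝓝 0) := by
    simpa using hns.const_mul m
  have hup : Tendsto (fun p => 2 * quadForm Ac (a p) + 2 * quadForm Ac (b p)
      - m * ‖((a p : H) - (b p : H))‖ ^ 2) atTop (𝓝 0) := by
    simpa using ((hqa.const_mul 2).add (hqb.const_mul 2)).sub (hnd.const_mul m)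
  refine tendsto_of_tendsto_of_tendsto_of_le_of_le hlow hup ?_ ?_
  · intro p
    simpa [quadForm] using hm (a p + b p)
  · intro p
    have h1 := hm (a p - b p)
    have h2 := par p
    simp only [Submodule.coe_sub] at h1
    change _ ≤ quadForm Ac (a p - b p) at h1
    change quadForm Ac (a p + b p) ≤ _
    linarith

theorem FormApprox.diff_tendsto {Ac : H →ₗ.[ℂ] H} {x : ℕ → Ac.domain} {u : H}
    (hx : FormApprox Ac x u) :
    Tendsto (fun p : ℕ × ℕ => ((x p.1 - x p.2 : Ac.domain) : H)) atTop (𝓝 0) := by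
  have h1 : Tendsto (fun p : ℕ × ℕ => (x p.1 : H)) atTop (𝓝 u) := by
    rw [← prod_atTop_atTop_eq]; exact hx.1.comp tendsto_fst
  have h2 : Tendsto (fun p : ℕ × ℕ => (x p.2 : H)) atTop (𝓝 u) := by
    rw [← prod_atTop_atTop_eq]; exact hx.1.comp tendsto_snd
  simpa using h1.sub h2

/-- The form domain: the completion of `D_c` in the form norm `((A_c x, x) + c (x, x))^(1/2)`,
realized as the subspace of `H` of limits of form-Cauchy sequences. -/
def formDomain (Ac : H →ₗ.[ℂ] H) (h : IsSemiboundedBelow Ac) : Submodule ℂ H where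
  carrier := {u | ∃ x : ℕ → Ac.domain, FormApprox Ac x u}
  zero_mem' := ⟨fun _ => 0, by simp [FormApprox, quadForm]⟩
  add_mem' := by
    rintro u v ⟨x, hx⟩ ⟨y, hy⟩
    refine ⟨fun n => x n + y n, by simpa using hx.1.add hy.1, ?_⟩
    have := quadForm_add_tendsto h hx.diff_tendsto hy.diff_tendsto hx.2 hy.2
    refine this.congr fun p => ?_
    rw [add_sub_add_comm]
  smul_mem' := by
    rintro c u ⟨x, hx⟩
    refine ⟨fun n => c • x n, by simpa using hx.1.const_smul c, ?_⟩
    have := hx.2.const_mul (‖c‖ ^ 2)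
    rw [mul_zero] at this
    refine this.congr fun p => ?_
    rw [← smul_sub]
    simp only [quadForm, LinearPMap.map_smul, Submodule.coe_smul, inner_smul_left,
      inner_smul_right]
    rw [← mul_assoc, Complex.mul_conj', ← Complex.ofReal_pow, Complex.re_ofReal_mul]

/-- The operator associated with a symmetric semibounded `A_c` by Friedrichs' construction:
the restriction of `A = A_c†` to those `u ∈ D_max` that lie in the form domain. -/
def friedrichsExtension [CompleteSpace H] (Ac : H →ₗ.[ℂ] H) (h : IsSemiboundedBelow Ac) :
    H →ₗ.[ℂ] H :=
  (Ac†).domRestrict (formDomain Ac h)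

/-! ### Hypotheses on the maximal and minimal domains -/

/-- The inclusion of the domain of `T`, with the graph norm `(‖T u‖² + ‖u‖²)^(1/2)`, into `H` is a
compact map. -/
def HasCompactDomain (T : H →ₗ.[ℂ] H) : Prop :=
  IsCompact (closure {u : H | ∃ x : T.domain, (x : H) = u ∧ ‖T x‖ ^ 2 + ‖(x : H)‖ ^ 2 ≤ 1})

/-- `D_min`, the domain of the closure of `A_c`, as a subspace of `D_max`. -/
def minDomainIn [CompleteSpace H] (Ac : H →ₗ.[ℂ] H) : Submodule ℂ (Ac†).domain :=
  Ac.closure.domain.submoduleOf (Ac†).domain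

/-! ### The boundary space and boundary functionals -/

/-- The graph inner product `(T u, T v) + (u, v)` (conjugate linear in the first slot). -/
def graphInner (T : H →ₗ.[ℂ] H) (u v : T.domain) : ℂ :=
  inner ℂ (T u) (T v) + inner ℂ (u : H) (v : H)

/-- The orthogonal complement `E` of `D_min` in `D_max` for the graph inner product. -/
def boundarySpace [CompleteSpace H] (Ac : H →ₗ.[ℂ] H) : Set (Ac†).domain :=
  {u | ∀ v ∈ minDomainIn Ac, graphInner (Ac†) v u = 0}

/-- For an extension `T` of `A_c` with domain `D + D_min`, where `D = dom T ∩ E`: the orthogonal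
complement `D^⊥` of `D` in `E` for the graph inner product. -/
def boundaryPerp [CompleteSpace H] (Ac T : H →ₗ.[ℂ] H) : Set (Ac†).domain :=
  {u | u ∈ boundarySpace Ac ∧
    ∀ w ∈ boundarySpace Ac, (w : H) ∈ T.domain → graphInner (Ac†) w u = 0}

/-- The functional `δ_u : v ↦ (A v, u) - (v, A u)` on the domain of a restriction `T` of
`A = A_c†`. -/
def boundaryFunctional [CompleteSpace H] (Ac T : H →ₗ.[ℂ] H) (u : (Ac†).domain) :
    T.domain →ₗ[ℂ] ℂ :=
  (innerₛₗ ℂ (u : H)).comp T.toFun - (innerₛₗ ℂ ((Ac†) u)).comp T.domain.subtype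

/-- The set of the functionals `δ_u`, `u ∈ D^⊥`. -/
def boundaryFunctionals [CompleteSpace H] (Ac T : H →ₗ.[ℂ] H) : Set (T.domain →ₗ[ℂ] ℂ) :=
  boundaryFunctional Ac T '' boundaryPerp Ac T

/-! ### The Sobolev spaces of an operator -/

/-- The eigenspace `ker (T - l)`. -/
def eigenspace (T : H →ₗ.[ℂ] H) (l : ℝ) : Submodule ℂ H where
  carrier := {u | ∃ x : T.domain, (x : H) = u ∧ T x = (l : ℂ) • u}
  zero_mem' := ⟨0, by simp⟩
  add_mem' := by
    rintro _ _ ⟨x, rfl, hx⟩ ⟨y, rfl, hy⟩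
    exact ⟨x + y, by simp, by simp [LinearPMap.map_add, hx, hy]⟩
  smul_mem' := by
    rintro c _ ⟨x, rfl, hx⟩
    exact ⟨c • x, by simp, by rw [LinearPMap.map_smul, hx, smul_comm]⟩

/-- The orthogonal projection on `ker (T - l)`. For a closed operator `T`, in particular a
selfadjoint one, the eigenspace is closed, and taking its closure changes nothing. -/
def spectralProj [CompleteSpace H] (T : H →ₗ.[ℂ] H) (l : ℝ) : H →L[ℂ] H :=
  (eigenspace T l).topologicalClosure.starProjection

theorem weight_nonneg (s l : ℝ) : 0 ≤ (1 + |l|) ^ (2 * s) := by positivity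

/-- The subspace `H^s_T` of those `u ∈ H` for which `∑ (1 + |l|)^(2 s) ‖Π_l u‖²` is finite. The
terms with `l` not an eigenvalue vanish, so for selfadjoint `T` with discrete spectrum the sum over
`l ∈ ℝ` is the sum over the spectrum. -/
def sobolevSubmodule [CompleteSpace H] (T : H →ₗ.[ℂ] H) (s : ℝ) : Submodule ℂ H where
  carrier := {u | Summable fun l : ℝ => (1 + |l|) ^ (2 * s) * ‖spectralProj T l u‖ ^ 2}
  zero_mem' := by simp
  add_mem' := by
    intro u v hu hv
    refine Summable.of_nonneg_of_le (fun l => mul_nonneg (weight_nonneg s l) (sq_nonneg _))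
      (fun l => ?_) ((hu.mul_left 2).add (hv.mul_left 2))
    have h0 := weight_nonneg s l
    have h1 : ‖spectralProj T l (u + v)‖ ^ 2
        ≤ 2 * ‖spectralProj T l u‖ ^ 2 + 2 * ‖spectralProj T l v‖ ^ 2 := by
      rw [map_add]
      nlinarith [norm_add_le (spectralProj T l u) (spectralProj T l v),
        norm_nonneg (spectralProj T l u + spectralProj T l v),
        sq_nonneg (‖spectralProj T l u‖ - ‖spectralProj T l v‖)]
    nlinarith [mul_le_mul_of_nonneg_left h1 h0]
  smul_mem' := by
    intro c u hu
    refine (Summable.mul_left (‖c‖ ^ 2) hu).congr fun l => ?_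
    rw [map_smul, norm_smul]
    ring

/-- `H^s_T` as a space of its own, so that it carries its own norm instead of the norm of `H`. -/
def SobolevSpace [CompleteSpace H] (T : H →ₗ.[ℂ] H) (s : ℝ) : Type _ := sobolevSubmodule T s

namespace SobolevSpace

variable [CompleteSpace H] {T : H →ₗ.[ℂ] H} {s : ℝ}

instance : AddCommGroup (SobolevSpace T s) := inferInstanceAs (AddCommGroup (sobolevSubmodule T s))

instance : Module ℂ (SobolevSpace T s) := inferInstanceAs (Module ℂ (sobolevSubmodule T s))

/-- The inclusion of `H^s_T` into `H`. -/
def toH : SobolevSpace T s →ₗ[ℂ] H := (sobolevSubmodule T s).subtype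

theorem summable_inner (u v : SobolevSpace T s) :
    Summable fun l : ℝ => (((1 + |l|) ^ (2 * s) : ℝ) : ℂ) *
      inner ℂ (spectralProj T l (toH u)) (spectralProj T l (toH v)) := by
  have hu : Summable fun l : ℝ => (1 + |l|) ^ (2 * s) * ‖spectralProj T l (toH u)‖ ^ 2 := u.2
  have hv : Summable fun l : ℝ => (1 + |l|) ^ (2 * s) * ‖spectralProj T l (toH v)‖ ^ 2 := v.2
  refine Summable.of_norm_bounded (hu.add hv) fun l => ?_
  have h0 := weight_nonneg s l
  rw [norm_mul, Complex.norm_real, Real.norm_of_nonneg h0, ← mul_add]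
  refine mul_le_mul_of_nonneg_left ?_ h0
  refine (norm_inner_le_norm _ _).trans ?_
  nlinarith [sq_nonneg (‖spectralProj T l (toH u)‖ - ‖spectralProj T l (toH v)‖),
    sq_nonneg ‖spectralProj T l (toH u)‖, sq_nonneg ‖spectralProj T l (toH v)‖]

/-- The inner product `∑ (1 + |l|)^(2 s) (Π_l u, Π_l v)`. -/
@[reducible]
def core (T : H →ₗ.[ℂ] H) (s : ℝ) : PreInnerProductSpace.Core ℂ (SobolevSpace T s) where
  inner u v := ∑' l : ℝ, (((1 + |l|) ^ (2 * s) : ℝ) : ℂ) *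
    inner ℂ (spectralProj T l (toH u)) (spectralProj T l (toH v))
  conj_inner_symm u v := by
    rw [Complex.conj_tsum]
    refine tsum_congr fun l => ?_
    rw [map_mul, Complex.conj_ofReal, inner_conj_symm]
  re_inner_nonneg u := by
    change 0 ≤ Complex.re _
    rw [Complex.re_tsum (summable_inner u u)]
    refine tsum_nonneg fun l => ?_
    rw [Complex.re_ofReal_mul]
    exact mul_nonneg (weight_nonneg s l) (inner_self_nonneg (𝕜 := ℂ))
  add_left u v w := by
    rw [← (summable_inner u w).tsum_add (summable_inner v w)]
    refine tsum_congr fun l => ?_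
    rw [map_add, map_add, inner_add_left, mul_add]
  smul_left u v c := by
    rw [← tsum_mul_left]
    refine tsum_congr fun l => ?_
    rw [map_smul, map_smul, inner_smul_left]
    ring

instance : SeminormedAddCommGroup (SobolevSpace T s) :=
  @InnerProductSpace.Core.toSeminormedAddCommGroup ℂ (SobolevSpace T s) _ _ _ (core T s)

instance : InnerProductSpace ℂ (SobolevSpace T s) := InnerProductSpace.ofCore (core T s)

end SobolevSpace

/-- The subspace `H^{-s}` of linear functionals on the domain of `T`: those that are the restriction
of an element of the dual of `H^s_T`. -/
def negSobolev [CompleteSpace H] (T : H →ₗ.[ℂ] H) (s : ℝ) : Set (T.domain →ₗ[ℂ] ℂ) :=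
  {φ | ∃ ψ : StrongDual ℂ (SobolevSpace T s),
    ∀ (v : T.domain) (w : SobolevSpace T s), w.toH = (v : H) → φ v = ψ w}

/-- The closure of `D_c` in `H^s_T`. -/
def sobolevClosure [CompleteSpace H] (Ac T : H →ₗ.[ℂ] H) (s : ℝ) : Set (SobolevSpace T s) :=
  closure {w | w.toH ∈ Ac.domain}

end

end FriedrichsRegularity

/-! Everything rests on the density of $\mathcal D_c$ in $H^{1/2}$. Choose $c$ with $A_c + c \ge 1$.
The form of $A_F + c$ is a limit of the form of $A_c + c$, and on $\mathcal D_F$ it controls the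
square of the $H^{1/2}$ norm (`IsShiftedInverse.sobolev_norm_sq_le`). Hence a sequence in $\mathcal
D_c$ approximating $u \in \mathcal D_F$ in the form sense also converges to $u$ in $H^{1/2}$. Finite
sums of eigenvectors lie in $\mathcal D_F$ and are dense in $H^{1/2}$, so $\mathcal D_c$ is dense
(`dense_sobolev_friedrichsExtension`).

The functional $\delta_u$ vanishes on $\mathcal D_c$ by the definition of the adjoint. If it were
continuous for the $H^{1/2}$ norm, it would vanish on $\mathcal D_F$, and surjectivity of $A_F + c$
would put $u$ in $\mathcal D_F$. Then $u \in D_F \cap D_F^\perp$, so $u = 0$.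

The spectral side needs only that $A_F + c$ has a compact symmetric inverse: surjectivity comes from
the Riesz theorem in the form completion, compactness from the embedding of $\mathcal D_{\max}$. -/

namespace FriedrichsRegularity

/-! ### Bounded and compact inverses of coercive operators -/

variable {H : Type*} [NormedAddCommGroup H] [InnerProductSpace ℂ H]

/-- `K` is a bounded inverse of `T + c`. -/
structure IsShiftedInverse (T : H →ₗ.[ℂ] H) (c : ℝ) (K : H →L[ℂ] H) : Prop where
  mem : ∀ f, K f ∈ T.domain
  right : ∀ f, T ⟨K f, mem f⟩ + (c : ℂ) • K f = f
  left : ∀ x : T.domain, K (T x + (c : ℂ) • (x : H)) = x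

/-- The form of `T + c` dominates the square of the norm. -/
def ShiftedCoercive (T : H →ₗ.[ℂ] H) (c : ℝ) : Prop :=
  ∀ x : T.domain, ‖(x : H)‖ ^ 2 ≤ (inner ℂ (x : H) (T x + (c : ℂ) • (x : H))).re

theorem ShiftedCoercive.norm_le {T : H →ₗ.[ℂ] H} {c : ℝ} (h : ShiftedCoercive T c)
    (x : T.domain) : ‖(x : H)‖ ≤ ‖T x + (c : ℂ) • (x : H)‖ := by
  have h1 := (h x).trans ((Complex.re_le_norm _).trans (norm_inner_le_norm _ _))
  rcases (norm_nonneg (x : H)).eq_or_lt with h0 | h0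
  · rw [← h0]; exact norm_nonneg _
  · rw [sq] at h1
    exact le_of_mul_le_mul_left h1 h0

/-- A coercive operator with surjective `T + c` has a bounded inverse of `T + c`, of norm at most
one. -/
theorem ShiftedCoercive.exists_isShiftedInverse {T : H →ₗ.[ℂ] H} {c : ℝ}
    (h : ShiftedCoercive T c)
    (hsurj : ∀ f : H, ∃ x : T.domain, T x + (c : ℂ) • (x : H) = f) :
    ∃ K : H →L[ℂ] H, IsShiftedInverse T c K ∧ ∀ f, ‖K f‖ ≤ ‖f‖ := by
  let L : T.domain →ₗ[ℂ] H := T.toFun + (c : ℂ) • T.domain.subtype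
  have hL : ∀ x, L x = T x + (c : ℂ) • (x : H) := fun x => rfl
  have hinj : Function.Injective L := by
    rw [← LinearMap.ker_eq_bot, LinearMap.ker_eq_bot']
    intro x hx
    have := h.norm_le x
    rw [← hL, hx, norm_zero] at this
    exact Subtype.ext (norm_le_zero_iff.1 this)
  let e : T.domain ≃ₗ[ℂ] H := LinearEquiv.ofBijective L ⟨hinj, hsurj⟩
  have he : ∀ f, T (e.symm f) + (c : ℂ) • (e.symm f : H) = f := fun f => e.apply_symm_apply f
  have hbound : ∀ f, ‖(T.domain.subtype ∘ₗ e.symm.toLinearMap) f‖ ≤ 1 * ‖f‖ := fun f => by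
    have := h.norm_le (e.symm f)
    rw [he] at this
    simpa using this
  refine ⟨LinearMap.mkContinuous (T.domain.subtype ∘ₗ e.symm.toLinearMap) 1 hbound,
    ⟨fun f => (e.symm f).2, he, fun x => ?_⟩, fun f => by simpa using hbound f⟩
  exact congrArg Subtype.val (e.symm_apply_apply x)

/-- Since $SKf = f - cKf$, the square of the graph norm of $Kf$ is at most $((1+|c|)^2 + 1)\|f\|^2
\le (2+|c|)^2\|f\|^2$. So $K$ maps the ball of radius $1/(2+|c|)$ into the relatively compact unit
ball of the graph norm. -/
theorem HasCompactDomain.isCompactOperator {S T : H →ₗ.[ℂ] H} (hS : HasCompactDomain S)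
    (hTS : T ≤ S) {c : ℝ} {K : H →L[ℂ] H} (hK : IsShiftedInverse T c K)
    (hK1 : ∀ f, ‖K f‖ ≤ ‖f‖) : IsCompactOperator K := by
  rw [isCompactOperator_iff_exists_mem_nhds_isCompact_closure_image]
  have hr : 0 < 1 / (2 + |c|) := by positivity
  refine ⟨Metric.closedBall 0 (1 / (2 + |c|)), Metric.closedBall_mem_nhds _ hr,
    hS.of_isClosed_subset isClosed_closure (closure_mono ?_)⟩
  rintro _ ⟨f, hf, rfl⟩
  rw [mem_closedBall_zero_iff] at hf
  refine ⟨⟨K f, hTS.1 (hK.mem f)⟩, rfl, ?_⟩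
  have h1 : S ⟨K f, hTS.1 (hK.mem f)⟩ = f - (c : ℂ) • K f := by
    rw [← hTS.2 (x := ⟨K f, hK.mem f⟩) rfl, eq_sub_iff_add_eq]
    exact hK.right f
  rw [h1]
  have h2 : ‖f - (c : ℂ) • K f‖ ≤ (1 + |c|) * ‖f‖ := by
    refine (norm_sub_le _ _).trans ?_
    rw [norm_smul, Complex.norm_real, Real.norm_eq_abs]
    nlinarith [mul_le_mul_of_nonneg_left (hK1 f) (abs_nonneg c)]
  have h3 : (2 + |c|) * ‖f‖ ≤ 1 := by
    rwa [le_div_iff₀' (by positivity)] at hf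
  have h4 := pow_le_pow_left₀ (norm_nonneg _) h2 2
  have h5 := pow_le_pow_left₀ (norm_nonneg _) (hK1 f) 2
  have h6 : ((2 + |c|) * ‖f‖) ^ 2 ≤ 1 := pow_le_one₀ (by positivity) h3
  change _ + ‖K f‖ ^ 2 ≤ 1
  nlinarith [abs_nonneg c, mul_nonneg (abs_nonneg c) (sq_nonneg ‖f‖), sq_nonneg ‖f‖]

/-! ### Eigenvector expansion and the space $H^{1/2}$ -/

section Spectral

variable {T : H →ₗ.[ℂ] H} {c : ℝ} {K : H →L[ℂ] H}

/-- Stated without dividing by $l + c$, so that it also covers $l = -c$, where both sides say $u =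
0$. -/
theorem IsShiftedInverse.mem_eigenspace_iff (hK : IsShiftedInverse T c K) {l : ℝ} {u : H} :
    u ∈ eigenspace T l ↔ ((l + c : ℝ) : ℂ) • K u = u := by
  constructor
  · rintro ⟨x, rfl, hx⟩
    have := hK.left x
    rw [hx, ← add_smul, map_smul] at this
    rw [Complex.ofReal_add]
    exact this
  · intro hu
    have hm : u ∈ T.domain := hu ▸ T.domain.smul_mem _ (hK.mem u)
    refine ⟨⟨u, hm⟩, rfl, ?_⟩
    have h1 : (⟨u, hm⟩ : T.domain) = ((l + c : ℝ) : ℂ) • (⟨K u, hK.mem u⟩ : T.domain) :=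
      Subtype.ext hu.symm
    have h2 := eq_sub_of_add_eq (hK.right u)
    rw [h1, LinearPMap.map_smul, h2, smul_sub, smul_comm _ (c : ℂ), hu, ← sub_smul]
    push_cast
    rw [add_sub_cancel_right]

theorem IsShiftedInverse.isClosed_eigenspace (hK : IsShiftedInverse T c K) (l : ℝ) :
    IsClosed (eigenspace T l : Set H) := by
  have : (eigenspace T l : Set H) = {u | ((l + c : ℝ) : ℂ) • K u = u} :=
    Set.ext fun u => hK.mem_eigenspace_iff
  rw [this]
  exact isClosed_eq (by fun_prop) continuous_id

theorem inner_eq_zero_of_mem_eigenspace (hT : T.IsFormalAdjoint T) {k l : ℝ} (hkl : k ≠ l)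
    {u v : H} (hu : u ∈ eigenspace T k) (hv : v ∈ eigenspace T l) : inner ℂ u v = 0 := by
  obtain ⟨x, rfl, hx⟩ := hu
  obtain ⟨y, rfl, hy⟩ := hv
  have h := hT x y
  rw [hx, hy, inner_smul_left, inner_smul_right, Complex.conj_ofReal] at h
  have h1 : ((k - l : ℝ) : ℂ) * inner ℂ (x : H) (y : H) = 0 := by
    push_cast; rw [sub_mul, h, sub_self]
  exact (mul_eq_zero.1 h1).resolve_left (by exact_mod_cast sub_ne_zero.2 hkl)

theorem IsShiftedInverse.isSymmetric (hK : IsShiftedInverse T c K) (hT : T.IsFormalAdjoint T) :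
    K.toLinearMap.IsSymmetric := by
  intro f g
  have h := hT ⟨K f, hK.mem f⟩ ⟨K g, hK.mem g⟩
  rw [eq_sub_of_add_eq (hK.right f), eq_sub_of_add_eq (hK.right g), inner_sub_left,
    inner_sub_right, inner_smul_left, inner_smul_right, Complex.conj_ofReal] at h
  exact (sub_left_inj.1 h).symm

variable [CompleteSpace H]

/-- The spectral theorem for the compact symmetric operator $K$. As $K$ is injective, its
eigenvalues $\mu$ are nonzero; they are real, and a $\mu$-eigenvector of $K$ is an eigenvector of
$T$ for $\mu^{-1} - c$. -/
theorem IsShiftedInverse.topologicalClosure_iSup_eigenspace (hK : IsShiftedInverse T c K)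
    (hT : T.IsFormalAdjoint T) (hcomp : IsCompactOperator K) :
    (⨆ l : ℝ, eigenspace T l).topologicalClosure = ⊤ := by
  have hsym := hK.isSymmetric hT
  rw [Submodule.topologicalClosure_eq_top_iff, eq_bot_iff,
    ← ContinuousLinearMap.orthogonalComplement_iSup_eigenspaces_eq_bot hcomp hsym]
  refine Submodule.orthogonal_le (iSup_le fun μ => ?_)
  intro u hu
  rw [Module.End.mem_eigenspace_iff] at hu
  change K u = μ • u at hu
  by_cases hu0 : u = 0
  · rw [hu0]; exact zero_mem _
  have hμ : μ ≠ 0 := by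
    rintro rfl
    rw [zero_smul] at hu
    have h := hK.right u
    have h0 : (⟨K u, hK.mem u⟩ : T.domain) = 0 := Subtype.ext hu
    rw [h0, LinearPMap.map_zero, hu, smul_zero, add_zero] at h
    exact hu0 h.symm
  have hreal : (starRingEnd ℂ) μ = μ :=
    hsym.conj_eigenvalue_eq_self (Module.End.hasEigenvalue_of_hasEigenvector
      ⟨Module.End.mem_eigenspace_iff.2 hu, hu0⟩)
  have hre : ((μ.re : ℝ) : ℂ) = μ := Complex.conj_eq_iff_re.1 hreal
  refine Submodule.mem_iSup_of_mem (μ.re⁻¹ - c) (hK.mem_eigenspace_iff.2 ?_)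
  rw [hu, sub_add_cancel, Complex.ofReal_inv, hre, inv_smul_smul₀ hμ]

theorem IsShiftedInverse.spectralProj_mem (hK : IsShiftedInverse T c K) (l : ℝ) (u : H) :
    spectralProj T l u ∈ eigenspace T l := by
  have := Submodule.starProjection_apply_mem (eigenspace T l).topologicalClosure u
  rwa [← SetLike.mem_coe, Submodule.topologicalClosure_coe,
    (hK.isClosed_eigenspace l).closure_eq] at this

theorem inner_spectralProj_left (l : ℝ) (u v : H) :
    inner ℂ (spectralProj T l u) v = inner ℂ u (spectralProj T l v) :=
  Submodule.inner_starProjection_left_eq_right _ u v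

theorem spectralProj_eq_self {l : ℝ} {u : H} (hu : u ∈ eigenspace T l) :
    spectralProj T l u = u :=
  Submodule.starProjection_eq_self_iff.2 (Submodule.le_topologicalClosure _ hu)

theorem IsShiftedInverse.spectralProj_eq_zero (hK : IsShiftedInverse T c K) {l : ℝ} {u : H}
    (hu : ∀ w ∈ eigenspace T l, inner ℂ w u = 0) : spectralProj T l u = 0 := by
  rw [← inner_self_eq_zero (𝕜 := ℂ), inner_spectralProj_left,
    spectralProj_eq_self (hK.spectralProj_mem l u), ← inner_conj_symm,
    hu _ (hK.spectralProj_mem l u), map_zero]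

theorem IsShiftedInverse.spectralProj_spectralProj (hK : IsShiftedInverse T c K)
    (hT : T.IsFormalAdjoint T) (k l : ℝ) (u : H) :
    spectralProj T k (spectralProj T l u) = if k = l then spectralProj T l u else 0 := by
  split_ifs with h
  · subst h; exact spectralProj_eq_self (hK.spectralProj_mem _ _)
  · exact hK.spectralProj_eq_zero fun w hw =>
      inner_eq_zero_of_mem_eigenspace hT h hw (hK.spectralProj_mem _ _)

/-- Every vector of a Hilbert space is a sum of components in a total family of mutually orthogonal
closed subspaces. -/
theorem exists_hasSum_of_orthogonalFamily {ι : Type*} {E : ι → Submodule ℂ H}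
    [∀ i, CompleteSpace (E i)]
    (hO : OrthogonalFamily ℂ (fun i => E i) fun i => (E i).subtypeₗᵢ)
    (htotal : (⨆ i, E i).topologicalClosure = ⊤) (u : H) :
    ∃ f : ∀ i, E i, HasSum (fun i => (f i : H)) u := by
  have hS := IsHilbertSum.mkInternal E hO htotal.ge
  refine ⟨fun i => hS.linearIsometryEquiv u i, ?_⟩
  have h := hS.hasSum_linearIsometryEquiv_symm (hS.linearIsometryEquiv u)
  rwa [LinearIsometryEquiv.symm_apply_apply] at h

theorem IsShiftedInverse.hasSum_spectralProj (hK : IsShiftedInverse T c K)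
    (hT : T.IsFormalAdjoint T) (hcomp : IsCompactOperator K) (u : H) :
    HasSum (fun l => spectralProj T l u) u := by
  have : ∀ l : ℝ, CompleteSpace (eigenspace T l) := fun l =>
    (hK.isClosed_eigenspace l).completeSpace_coe
  have hO : OrthogonalFamily ℂ (fun l : ℝ => eigenspace T l)
      fun l => (eigenspace T l).subtypeₗᵢ := by
    refine OrthogonalFamily.of_pairwise fun k l hkl => ?_
    rw [Function.onFun, Submodule.isOrtho_iff_inner_eq]
    exact fun x hx y hy => inner_eq_zero_of_mem_eigenspace hT hkl hx hy
  obtain ⟨f, hf⟩ := exists_hasSum_of_orthogonalFamily hO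
    (hK.topologicalClosure_iSup_eigenspace hT hcomp) u
  -- Applying the continuous projection $\Pi_k$ to the series kills every term but the $k$-th, so
  -- the abstract components are the spectral projections.
  have hproj : ∀ k, spectralProj T k u = f k := fun k => by
    have hk : HasSum (fun l => spectralProj T k (f l)) (spectralProj T k u) :=
      hf.mapL (spectralProj T k)
    have hz : ∀ l, l ≠ k → spectralProj T k (f l) = 0 := fun l hlk =>
      hK.spectralProj_eq_zero fun w hw =>
        inner_eq_zero_of_mem_eigenspace hT (Ne.symm hlk) hw (f l).2
    rw [hk.unique (hasSum_single k hz), spectralProj_eq_self (f k).2]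
  simp_rw [hproj]
  exact hf

theorem IsShiftedInverse.hasSum_inner_spectralProj (hK : IsShiftedInverse T c K)
    (hT : T.IsFormalAdjoint T) (hcomp : IsCompactOperator K) (u v : H) :
    HasSum (fun l => inner ℂ (spectralProj T l u) (spectralProj T l v)) (inner ℂ u v) := by
  have h := (hK.hasSum_spectralProj hT hcomp v).mapL (innerSL ℂ u)
  refine h.congr_fun fun l => ?_
  rw [inner_spectralProj_left, spectralProj_eq_self (hK.spectralProj_mem l v)]
  rfl

theorem IsShiftedInverse.hasSum_norm_sq_spectralProj (hK : IsShiftedInverse T c K)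
    (hT : T.IsFormalAdjoint T) (hcomp : IsCompactOperator K) (u : H) :
    HasSum (fun l => ‖spectralProj T l u‖ ^ 2) (‖u‖ ^ 2) := by
  have h := Complex.hasSum_re (hK.hasSum_inner_spectralProj hT hcomp u u)
  convert! h using 1
  · funext l; exact norm_sq_eq_re_inner (𝕜 := ℂ) _
  · exact norm_sq_eq_re_inner (𝕜 := ℂ) _

/-- By symmetry, $Tx - lx$ is orthogonal to $\ker(T - l)$. -/
theorem IsShiftedInverse.spectralProj_apply (hK : IsShiftedInverse T c K)
    (hT : T.IsFormalAdjoint T) (l : ℝ) (x : T.domain) :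
    spectralProj T l (T x) = (l : ℂ) • spectralProj T l x := by
  rw [← sub_eq_zero, ← map_smul, ← map_sub]
  refine hK.spectralProj_eq_zero ?_
  rintro _ ⟨w, rfl, hw⟩
  rw [inner_sub_right, ← hT w x, hw, inner_smul_left, inner_smul_right, Complex.conj_ofReal,
    sub_self]

theorem IsShiftedInverse.hasSum_form (hK : IsShiftedInverse T c K)
    (hT : T.IsFormalAdjoint T) (hcomp : IsCompactOperator K) (x : T.domain) :
    HasSum (fun l => (l + c) * ‖spectralProj T l x‖ ^ 2)
      (inner ℂ (x : H) (T x + (c : ℂ) • (x : H))).re := by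
  have h := Complex.hasSum_re
    (hK.hasSum_inner_spectralProj hT hcomp x (T x + (c : ℂ) • (x : H)))
  refine h.congr_fun fun l => ?_
  rw [map_add, hK.spectralProj_apply hT, map_smul, ← add_smul, inner_smul_right,
    ← Complex.ofReal_add, Complex.re_ofReal_mul, norm_sq_eq_re_inner (𝕜 := ℂ)]
  rfl

theorem weight_half (l : ℝ) : (1 + |l|) ^ (2 * (1 / 2 : ℝ)) = 1 + |l| := by norm_num

theorem IsShiftedInverse.domain_le_sobolevSubmodule (hK : IsShiftedInverse T c K)
    (hT : T.IsFormalAdjoint T) (hcomp : IsCompactOperator K) :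
    T.domain ≤ sobolevSubmodule T (1 / 2) := by
  intro u hu
  have h1 := (hK.hasSum_norm_sq_spectralProj hT hcomp u).summable.mul_left 2
  have h2 := (hK.hasSum_norm_sq_spectralProj hT hcomp (T ⟨u, hu⟩)).summable
  refine Summable.of_nonneg_of_le (fun l => mul_nonneg (weight_nonneg _ l) (sq_nonneg _))
    (fun l => ?_) (h1.add h2)
  -- Termwise this is $1 + |l| \le 2 + l^2$; the two majorants are the expansions of $2\|u\|^2$ and
  -- $\|Tu\|^2$.
  rw [weight_half, hK.spectralProj_apply hT, norm_smul, Complex.norm_real, Real.norm_eq_abs,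
    mul_pow, ← add_mul]
  exact mul_le_mul_of_nonneg_right (by nlinarith [sq_nonneg (|l| - 1)]) (sq_nonneg _)

theorem SobolevSpace.hasSum_norm_sq (w : SobolevSpace T (1 / 2)) :
    HasSum (fun l => (1 + |l|) * ‖spectralProj T l w.toH‖ ^ 2) (‖w‖ ^ 2) := by
  have h := Complex.hasSum_re (SobolevSpace.summable_inner w w).hasSum
  rw [norm_sq_eq_re_inner (𝕜 := ℂ)]
  refine h.congr_fun fun l => ?_
  rw [Complex.re_ofReal_mul, weight_half, norm_sq_eq_re_inner (𝕜 := ℂ)]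
  rfl

/-- Coercivity tested on an eigenvector gives $l + c \ge 1$ for each $l$ that contributes, whence $1
+ |l| \le 1 + (l + c) + |c| \le (2 + |c|)(l + c)$. Summing compares the two expansions. -/
theorem IsShiftedInverse.sobolev_norm_sq_le (hK : IsShiftedInverse T c K)
    (hT : T.IsFormalAdjoint T) (hcomp : IsCompactOperator K) (hc : ShiftedCoercive T c)
    (w : SobolevSpace T (1 / 2)) (x : T.domain) (hwx : w.toH = (x : H)) :
    ‖w‖ ^ 2 ≤ (2 + |c|) * (inner ℂ (x : H) (T x + (c : ℂ) • (x : H))).re := by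
  refine hasSum_le (fun l => ?_) (SobolevSpace.hasSum_norm_sq w)
    ((hK.hasSum_form hT hcomp x).mul_left (2 + |c|))
  rw [hwx, ← mul_assoc]
  by_cases h0 : spectralProj T l x = 0
  · simp [h0]
  refine mul_le_mul_of_nonneg_right ?_ (sq_nonneg _)
  obtain ⟨e, he, hTe⟩ := hK.spectralProj_mem l (x : H)
  have h1 := hc e
  rw [hTe, ← he, ← add_smul, inner_smul_right, ← Complex.ofReal_add, Complex.re_ofReal_mul] at h1
  have h2 : (inner ℂ (e : H) (e : H)).re = ‖(e : H)‖ ^ 2 := (norm_sq_eq_re_inner (𝕜 := ℂ) _).symm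
  have h3 : 0 < ‖(e : H)‖ ^ 2 := by rw [he]; positivity
  rw [h2] at h1
  have h4 : 1 ≤ l + c := by
    by_contra! hlt
    nlinarith
  have h5 : |l| ≤ (l + c) + |c| := by
    calc |l| = |(l + c) - c| := by rw [add_sub_cancel_right]
      _ ≤ |l + c| + |c| := abs_sub _ _
      _ = _ := by rw [abs_of_nonneg (by linarith)]
  nlinarith [abs_nonneg c]

/-- The domain of `T` is dense in `H^{1/2}_T`. -/
theorem IsShiftedInverse.dense_domain_sobolev (hK : IsShiftedInverse T c K)
    (hT : T.IsFormalAdjoint T) :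
    Dense {w : SobolevSpace T (1 / 2) | w.toH ∈ T.domain} := by
  classical
  intro w
  have hsum := SobolevSpace.hasSum_norm_sq w
  have hmem : ∀ F : Finset ℝ, ∑ l ∈ F, spectralProj T l w.toH ∈ T.domain := fun F =>
    T.domain.sum_mem fun l _ => by
      obtain ⟨e, he, -⟩ := hK.spectralProj_mem l w.toH
      rw [← he]; exact e.2
  have hproj : ∀ (F : Finset ℝ) (k : ℝ), spectralProj T k (∑ l ∈ F, spectralProj T l w.toH)
      = if k ∈ F then spectralProj T k w.toH else 0 := fun F k => by
    rw [map_sum, Finset.sum_congr rfl fun l _ => hK.spectralProj_spectralProj hT k l w.toH,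
      Finset.sum_ite_eq]
  have hsob : ∀ F : Finset ℝ,
      ∑ l ∈ F, spectralProj T l w.toH ∈ sobolevSubmodule T (1 / 2) := fun F => by
    refine summable_of_ne_finset_zero (s := F) fun k hk => ?_
    rw [hproj, if_neg hk]; simp
  -- The approximants are finite spectral partial sums of $w$. The components of $v_F - w$ are those
  -- outside $F$, up to sign, so its squared norm is a tail of a convergent series.
  let v : Finset ℝ → SobolevSpace T (1 / 2) := fun F => ⟨_, hsob F⟩
  have hv : ∀ F, (v F).toH = ∑ l ∈ F, spectralProj T l w.toH := fun F => rfl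
  have hnorm : ∀ F, ‖v F - w‖ ^ 2
      = ∑' l : {l : ℝ // l ∉ F}, (1 + |(l : ℝ)|) * ‖spectralProj T l w.toH‖ ^ 2 := fun F => by
    rw [← (SobolevSpace.hasSum_norm_sq (v F - w)).tsum_eq]
    refine Eq.trans (tsum_congr fun l => ?_)
      (tsum_subtype {l : ℝ | l ∉ F} fun l => (1 + |l|) * ‖spectralProj T l w.toH‖ ^ 2).symm
    rw [map_sub, hv, map_sub, hproj]
    by_cases hl : l ∈ F <;> simp [hl]
  have hlim : Tendsto (fun F => ‖v F - w‖ ^ 2) atTop (𝓝 0) := by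
    simp_rw [hnorm]
    exact tendsto_tsum_compl_atTop_zero fun l : ℝ => (1 + |l|) * ‖spectralProj T l w.toH‖ ^ 2
  have hlim' : Tendsto v atTop (𝓝 w) := by
    rw [tendsto_iff_norm_sub_tendsto_zero]
    simpa using hlim.sqrt
  exact mem_closure_of_tendsto hlim' (Eventually.of_forall hmem)

end Spectral

end FriedrichsRegularity

/-! ### Form-Cauchy sequences in $\mathcal D_c$ -/

namespace FriedrichsRegularity

/-- A functional that is bounded for a positive semidefinite form is represented by a sequence
that is Cauchy for the form. -/
theorem exists_seq_representing {V : Type*} [AddCommGroup V] [Module ℂ V]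
    (core : PreInnerProductSpace.Core ℂ V) (φ : V →ₗ[ℂ] ℂ) (C : ℝ)
    (hφ : ∀ y, ‖φ y‖ ≤ C * √(core.inner y y).re) :
    ∃ x : ℕ → V,
      Tendsto (fun p : ℕ × ℕ => (core.inner (x p.1 - x p.2) (x p.1 - x p.2)).re) atTop (𝓝 0) ∧
      ∀ y, Tendsto (fun n => core.inner (x n) y) atTop (𝓝 (φ y)) := by
  -- The form is only semidefinite and $V$ need not be complete, so the Riesz vector $\xi$ is found
  -- in the Hilbert completion; the sequence is any one from $V$ converging to $\xi$.
  let _ : SeminormedAddCommGroup V :=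
    @InnerProductSpace.Core.toSeminormedAddCommGroup ℂ V _ _ _ core
  let _ : InnerProductSpace ℂ V := InnerProductSpace.ofCore core
  have hinner : ∀ x y : V, core.inner x y = inner ℂ x y := fun _ _ => rfl
  have hnorm : ∀ x : V, √(core.inner x x).re = ‖x‖ := fun _ => rfl
  simp_rw [hnorm] at hφ
  simp_rw [hinner]
  let ψ : UniformSpace.Completion V →L[ℂ] ℂ :=
    (LinearMap.mkContinuous φ C hφ).extend UniformSpace.Completion.toComplL
  have hψ : ∀ y : V, ψ y = φ y := fun y =>
    ContinuousLinearMap.extend_eq _ (e := UniformSpace.Completion.toComplL (𝕜 := ℂ))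
      UniformSpace.Completion.denseRange_coe
      (UniformSpace.Completion.isUniformInducing_coe V) y
  let ξ := (InnerProductSpace.toDual ℂ (UniformSpace.Completion V)).symm ψ
  have hξ : ∀ η, inner ℂ ξ η = ψ η := fun η => InnerProductSpace.toDual_symm_apply
  obtain ⟨z, hz, hzξ⟩ := mem_closure_iff_seq_limit.1
    (UniformSpace.Completion.denseRange_coe (α := V) ξ)
  choose x hx using hz
  have hlim : Tendsto (fun n => (x n : UniformSpace.Completion V)) atTop (𝓝 ξ) := by
    simpa only [hx] using hzξ
  refine ⟨x, ?_, fun y => ?_⟩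
  · have h1 : Tendsto (fun p : ℕ × ℕ => (x p.1 : UniformSpace.Completion V)) atTop (𝓝 ξ) := by
      rw [← prod_atTop_atTop_eq]; exact hlim.comp tendsto_fst
    have h2 : Tendsto (fun p : ℕ × ℕ => (x p.2 : UniformSpace.Completion V)) atTop (𝓝 ξ) := by
      rw [← prod_atTop_atTop_eq]; exact hlim.comp tendsto_snd
    have h3 := (h1.sub h2).norm.pow 2
    rw [sub_self, norm_zero, zero_pow two_ne_zero] at h3
    refine h3.congr fun p => ?_
    rw [← UniformSpace.Completion.coe_sub, UniformSpace.Completion.norm_coe]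
    exact norm_sq_eq_re_inner (𝕜 := ℂ) _
  · rw [← hψ, ← hξ]
    refine (hlim.inner tendsto_const_nhds).congr fun n => ?_
    exact UniformSpace.Completion.inner_coe _ _

variable {H : Type*} [NormedAddCommGroup H] [InnerProductSpace ℂ H] {Ac : H →ₗ.[ℂ] H} {c : ℝ}

/-- The sesquilinear form `(x, (A_c + c) y)` as a semidefinite inner product on `D_c`. -/
@[reducible]
noncomputable def shiftedCore (hsym : Ac.IsFormalAdjoint Ac) (hc : ShiftedCoercive Ac c) :
    PreInnerProductSpace.Core ℂ Ac.domain where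
  inner x y := inner ℂ (x : H) (Ac y + (c : ℂ) • (y : H))
  conj_inner_symm x y := by
    rw [inner_conj_symm, inner_add_left, inner_add_right, inner_smul_left, inner_smul_right,
      Complex.conj_ofReal, hsym]
  re_inner_nonneg x := (sq_nonneg _).trans (hc x)
  add_left x y z := by rw [Submodule.coe_add, inner_add_left]
  smul_left x y r := by rw [Submodule.coe_smul, inner_smul_left]

theorem shifted_form_eq (x : Ac.domain) :
    (inner ℂ (x : H) (Ac x + (c : ℂ) • (x : H))).re = quadForm Ac x + c * ‖(x : H)‖ ^ 2 := by
  rw [inner_add_right, inner_smul_right, Complex.add_re, Complex.re_ofReal_mul, quadForm,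
    norm_sq_eq_re_inner (𝕜 := ℂ)]
  rfl

theorem ShiftedCoercive.norm_form_sq_le (hsym : Ac.IsFormalAdjoint Ac) (hc : ShiftedCoercive Ac c)
    (x y : Ac.domain) :
    ‖inner ℂ (x : H) (Ac y + (c : ℂ) • (y : H))‖ ^ 2 ≤
      (inner ℂ (x : H) (Ac x + (c : ℂ) • (x : H))).re *
        (inner ℂ (y : H) (Ac y + (c : ℂ) • (y : H))).re := by
  have h := @InnerProductSpace.Core.inner_mul_inner_self_le ℂ Ac.domain _ _ _
    (shiftedCore hsym hc) x y
  have h1 : inner ℂ (x : H) (Ac y + (c : ℂ) • (y : H))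
      = (starRingEnd ℂ) (inner ℂ (y : H) (Ac x + (c : ℂ) • (x : H))) :=
    ((shiftedCore hsym hc).conj_inner_symm x y).symm
  have h2 : ‖inner ℂ (y : H) (Ac x + (c : ℂ) • (x : H))‖
      = ‖inner ℂ (x : H) (Ac y + (c : ℂ) • (y : H))‖ := by rw [h1, RCLike.norm_conj]
  change ‖inner ℂ (x : H) (Ac y + (c : ℂ) • (y : H))‖ *
    ‖inner ℂ (y : H) (Ac x + (c : ℂ) • (x : H))‖ ≤ _ at h
  rw [h2, ← sq] at h
  exact h

theorem IsSemiboundedBelow.exists_shiftedCoercive (h : IsSemiboundedBelow Ac) :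
    ∃ c : ℝ, ShiftedCoercive Ac c := by
  obtain ⟨-, m, hm⟩ := h
  -- The lower bound $m$ is shifted to $1$.
  refine ⟨1 - m, fun x => ?_⟩
  rw [shifted_form_eq]
  have := hm x
  change _ ≤ quadForm Ac x at this
  linarith

theorem FormApprox.shifted_tendsto {x : ℕ → Ac.domain} {u : H} (hx : FormApprox Ac x u) (c : ℝ) :
    Tendsto (fun p : ℕ × ℕ => (inner ℂ ((x p.1 - x p.2 : Ac.domain) : H)
      (Ac (x p.1 - x p.2) + (c : ℂ) • ((x p.1 - x p.2 : Ac.domain) : H))).re) atTop (𝓝 0) := by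
  simp_rw [shifted_form_eq]
  simpa using hx.2.add ((hx.diff_tendsto.norm.pow 2).const_mul c)

theorem FormApprox.sub_const {x : ℕ → Ac.domain} {u : H} (hx : FormApprox Ac x u)
    (y : Ac.domain) : FormApprox Ac (fun n => x n - y) (u - y) :=
  ⟨hx.1.sub_const _, by simpa using hx.2⟩

theorem FormApprox.const (y : Ac.domain) : FormApprox Ac (fun _ => y) (y : H) :=
  ⟨tendsto_const_nhds, by simp [quadForm]⟩

theorem FormApprox.exists_shifted_le (hc : ShiftedCoercive Ac c)
    {x : ℕ → Ac.domain} {u : H} (hx : FormApprox Ac x u) :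
    ∃ B : ℝ, ∀ᶠ n in atTop,
      (inner ℂ (x n : H) (Ac (x n) + (c : ℂ) • (x n : H))).re ≤ B := by
  have h := hx.shifted_tendsto c
  rw [← prod_atTop_atTop_eq] at h
  obtain ⟨N, hN⟩ := ((h.eventually_lt_const zero_lt_one).curry).exists
  refine ⟨2 + 2 * (inner ℂ (x N : H) (Ac (x N) + (c : ℂ) • (x N : H))).re, ?_⟩
  filter_upwards [hN] with n hn
  -- Write $q$ for the shifted form. The parallelogram law with $q(2x_N - x_n) \ge 0$ gives $q(x_n)
  -- \le 2q(x_N) + 2q(x_N - x_n)$, and the last form value is below $1$.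
  have h2 := (sq_nonneg _).trans (hc (x N + (x N - x n)))
  simp only [LinearPMap.map_add, LinearPMap.map_sub, Submodule.coe_add, Submodule.coe_sub,
    smul_add, smul_sub, inner_add_left, inner_add_right, inner_sub_left, inner_sub_right,
    Complex.add_re, Complex.sub_re] at hn h2 ⊢
  linarith

variable [CompleteSpace H]

/-- The form of `A_c + c` along form-convergent sequences converges to the pairing with
`(A_c† + c) u`. -/
theorem FormApprox.tendsto_form (hdense : Dense (Ac.domain : Set H))
    (hsym : Ac.IsFormalAdjoint Ac) (hc : ShiftedCoercive Ac c) {x y : ℕ → Ac.domain}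
    {u : (Ac†).domain} {v : H} (hx : FormApprox Ac x u) (hy : FormApprox Ac y v) :
    Tendsto (fun n => inner ℂ (x n : H) (Ac (y n) + (c : ℂ) • (y n : H))) atTop
      (𝓝 (inner ℂ (Ac† u + (c : ℂ) • (u : H)) v)) := by
  obtain ⟨B, hB⟩ := hy.exists_shifted_le hc
  have h1 : Tendsto (fun n => inner ℂ (u : H) (Ac (y n) + (c : ℂ) • (y n : H))) atTop
      (𝓝 (inner ℂ (Ac† u + (c : ℂ) • (u : H)) v)) := by
    refine (tendsto_const_nhds.inner hy.1).congr fun n => ?_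
    rw [inner_add_left, inner_add_right, LinearPMap.adjoint_isFormalAdjoint hdense u (y n),
      inner_smul_left, inner_smul_right, Complex.conj_ofReal]
  -- Replacing $u$ by $x_k$, Cauchy–Schwarz for the form bounds the squared pairing by the form
  -- value of $x_n - x_k$, which is small, times that of $y_n$, which is at most $B$. Then $k \to
  -- \infty$ with $n$ fixed.
  have h2 : Tendsto (fun n => inner ℂ ((x n : H) - u) (Ac (y n) + (c : ℂ) • (y n : H))) atTop
      (𝓝 0) := by
    rw [tendsto_zero_iff_norm_tendsto_zero, Metric.tendsto_atTop]
    intro ε hε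
    have hB' : 0 < |B| + 1 := by positivity
    have hδ : 0 < (ε / 2) ^ 2 / (|B| + 1) := by positivity
    have h := hx.shifted_tendsto c
    rw [← prod_atTop_atTop_eq] at h
    have hN := ((h.eventually_lt_const hδ).curry).and hB
    obtain ⟨N, hN⟩ := eventually_atTop.1 hN
    refine ⟨N, fun n hn => ?_⟩
    obtain ⟨hn1, hn2⟩ := hN n hn
    have hlim : Tendsto (fun k => ‖inner ℂ ((x n : H) - x k) (Ac (y n) + (c : ℂ) • (y n : H))‖)
        atTop (𝓝 ‖inner ℂ ((x n : H) - u) (Ac (y n) + (c : ℂ) • (y n : H))‖) :=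
      ((tendsto_const_nhds.sub hx.1).inner tendsto_const_nhds).norm
    have hle : ‖inner ℂ ((x n : H) - u) (Ac (y n) + (c : ℂ) • (y n : H))‖ ≤ ε / 2 := by
      refine le_of_tendsto hlim ?_
      filter_upwards [hn1] with k hk
      refine le_of_sq_le_sq ?_ (by positivity)
      have hcs := hc.norm_form_sq_le hsym (x n - x k) (y n)
      have h0 := (sq_nonneg _).trans (hc (x n - x k))
      calc _ ≤ _ := hcs
        _ ≤ (ε / 2) ^ 2 / (|B| + 1) * (|B| + 1) := by
          refine mul_le_mul hk.le ?_ ((sq_nonneg _).trans (hc (y n))) hδ.le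
          linarith [le_abs_self B]
        _ = (ε / 2) ^ 2 := div_mul_cancel₀ _ hB'.ne'
    rw [Real.dist_eq, sub_zero, abs_norm]
    linarith
  refine ((h2.add h1).congr fun n => ?_).trans_eq (by rw [zero_add])
  rw [← inner_add_left, sub_add_cancel]

/-! ### The Friedrichs extension is symmetric, coercive and surjective after the shift -/

theorem le_friedrichsExtension (hdense : Dense (Ac.domain : Set H)) (h : IsSemiboundedBelow Ac) :
    Ac.domain ≤ (friedrichsExtension Ac h).domain := fun x hx =>
  ⟨⟨_, FormApprox.const ⟨x, hx⟩⟩, (LinearPMap.IsFormalAdjoint.le_adjoint hdense h.1).1 hx⟩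

theorem friedrichsExtension_le_adjoint (h : IsSemiboundedBelow Ac) :
    friedrichsExtension Ac h ≤ Ac† := LinearPMap.domRestrict_le

theorem friedrichsExtension_apply (h : IsSemiboundedBelow Ac)
    (x : (friedrichsExtension Ac h).domain) :
    friedrichsExtension Ac h x = Ac† ⟨x, x.2.2⟩ := (friedrichsExtension_le_adjoint h).2 rfl

theorem friedrichsExtension_tendsto (hdense : Dense (Ac.domain : Set H))
    (h : IsSemiboundedBelow Ac) (hc : ShiftedCoercive Ac c) {x : ℕ → Ac.domain}
    {u : (friedrichsExtension Ac h).domain} (hx : FormApprox Ac x u) :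
    Tendsto (fun n => (inner ℂ (x n : H) (Ac (x n) + (c : ℂ) • (x n : H))).re) atTop
      (𝓝 (inner ℂ (u : H) (friedrichsExtension Ac h u + (c : ℂ) • (u : H))).re) := by
  have hx' : FormApprox Ac x (⟨u, u.2.2⟩ : (Ac†).domain) := hx
  have := (Complex.continuous_re.tendsto _).comp (hx'.tendsto_form hdense h.1 hc hx)
  rw [friedrichsExtension_apply]
  convert! this using 2
  exact inner_re_symm (𝕜 := ℂ) _ _

theorem friedrichsExtension_shiftedCoercive (hdense : Dense (Ac.domain : Set H))
    (h : IsSemiboundedBelow Ac) (hc : ShiftedCoercive Ac c) :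
    ShiftedCoercive (friedrichsExtension Ac h) c := by
  intro u
  obtain ⟨x, hx⟩ := u.2.1
  exact le_of_tendsto_of_tendsto' (hx.1.norm.pow 2) (friedrichsExtension_tendsto hdense h hc hx)
    fun n => hc (x n)

/-- The form on $\mathcal D_c$ is Hermitian, so $((A+c)u, v)$ and $(u, (A+c)v)$ are limits of the
same sequence; $c$ is real and cancels. -/
theorem friedrichsExtension_isFormalAdjoint (hdense : Dense (Ac.domain : Set H))
    (h : IsSemiboundedBelow Ac) :
    (friedrichsExtension Ac h).IsFormalAdjoint (friedrichsExtension Ac h) := by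
  intro u v
  obtain ⟨c, hc⟩ := h.exists_shiftedCoercive
  obtain ⟨x, hx⟩ := u.2.1
  obtain ⟨y, hy⟩ := v.2.1
  have hu : FormApprox Ac x (⟨u, u.2.2⟩ : (Ac†).domain) := hx
  have hv : FormApprox Ac y (⟨v, v.2.2⟩ : (Ac†).domain) := hy
  have h1 := hu.tendsto_form hdense h.1 hc hy
  have h2 := (Complex.continuous_conj.tendsto _).comp (hv.tendsto_form hdense h.1 hc hx)
  have h3 := tendsto_nhds_unique h1
    (h2.congr fun n => (shiftedCore h.1 hc).conj_inner_symm (x n) (y n))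
  rw [inner_conj_symm, inner_add_left, inner_add_right, inner_smul_left, inner_smul_right,
    Complex.conj_ofReal] at h3
  rw [friedrichsExtension_apply, friedrichsExtension_apply]
  exact add_right_cancel h3

/-- Pairing with $f$ is bounded in the form norm, since that norm dominates the norm of $H$. The
representing form-Cauchy sequence therefore converges in $H$ to some $u$ that pairs with $(A_c +
c)y$ as $f$ pairs with $y$, which says $u \in \mathcal D_{\max}$ and $Au = f - cu$. -/
theorem friedrichsExtension_surjective (hdense : Dense (Ac.domain : Set H))
    (h : IsSemiboundedBelow Ac) (hc : ShiftedCoercive Ac c) (f : H) :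
    ∃ u : (friedrichsExtension Ac h).domain,
      friedrichsExtension Ac h u + (c : ℂ) • (u : H) = f := by
  obtain ⟨x, hx, hxf⟩ := exists_seq_representing (shiftedCore h.1 hc)
    ((innerₛₗ ℂ f).comp Ac.domain.subtype) ‖f‖ fun y => by
      refine (norm_inner_le_norm f (y : H)).trans (mul_le_mul_of_nonneg_left ?_ (norm_nonneg f))
      exact Real.le_sqrt_of_sq_le (hc y)
  change Tendsto (fun p : ℕ × ℕ => (inner ℂ ((x p.1 - x p.2 : Ac.domain) : H)
      (Ac (x p.1 - x p.2) + (c : ℂ) • ((x p.1 - x p.2 : Ac.domain) : H))).re) atTop (𝓝 0) at hx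
  change ∀ y : Ac.domain, Tendsto (fun n => inner ℂ (x n : H) (Ac y + (c : ℂ) • (y : H))) atTop
    (𝓝 (inner ℂ f (y : H))) at hxf
  have hsq : Tendsto (fun p : ℕ × ℕ => ‖((x p.1 - x p.2 : Ac.domain) : H)‖ ^ 2) atTop (𝓝 0) :=
    squeeze_zero (fun _ => sq_nonneg _) (fun p => hc (x p.1 - x p.2)) hx
  have hcauchy : CauchySeq fun n => (x n : H) := by
    rw [cauchySeq_iff_tendsto_dist_atTop_0]
    simpa [dist_eq_norm] using hsq.sqrt
  obtain ⟨u, hu⟩ := cauchySeq_tendsto_of_complete hcauchy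
  have happrox : FormApprox Ac x u := by
    refine ⟨hu, ?_⟩
    have := hx.sub (hsq.const_mul c)
    rw [mul_zero, sub_zero] at this
    refine this.congr fun p => ?_
    rw [shifted_form_eq, add_sub_cancel_right]
  have hadj : ∀ y : Ac.domain, inner ℂ (f - (c : ℂ) • u) (y : H) = inner ℂ u (Ac y) := fun y => by
    have h1 := tendsto_nhds_unique (hxf y) (hu.inner tendsto_const_nhds)
    rw [inner_sub_left, h1, inner_add_right, inner_smul_left, inner_smul_right,
      Complex.conj_ofReal, add_sub_cancel_right]
  have hmem : u ∈ (Ac†).domain := LinearPMap.mem_adjoint_domain_of_exists _ ⟨_, hadj⟩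
  refine ⟨⟨u, ⟨x, happrox⟩, hmem⟩, ?_⟩
  rw [friedrichsExtension_apply, LinearPMap.adjoint_apply_eq hdense ⟨u, hmem⟩ hadj, sub_add_cancel]

theorem friedrichsExtension_exists_isShiftedInverse (hdense : Dense (Ac.domain : Set H))
    (h : IsSemiboundedBelow Ac) (hcompact : HasCompactDomain (Ac†)) (hc : ShiftedCoercive Ac c) :
    ∃ K : H →L[ℂ] H, IsShiftedInverse (friedrichsExtension Ac h) c K ∧ IsCompactOperator K := by
  obtain ⟨K, hK, hK1⟩ := (friedrichsExtension_shiftedCoercive hdense h hc).exists_isShiftedInverse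
    (friedrichsExtension_surjective hdense h hc)
  exact ⟨K, hK, hcompact.isCompactOperator (friedrichsExtension_le_adjoint h) hK hK1⟩

/-! ### Density of $\mathcal D_c$ and the boundary functionals -/

/-- `D_c` is dense in `H^{1/2}` of the Friedrichs extension. -/
theorem dense_sobolev_friedrichsExtension (hdense : Dense (Ac.domain : Set H))
    (h : IsSemiboundedBelow Ac) (hcompact : HasCompactDomain (Ac†)) :
    Dense {w : SobolevSpace (friedrichsExtension Ac h) (1 / 2) | w.toH ∈ Ac.domain} := by
  obtain ⟨c, hc⟩ := h.exists_shiftedCoercive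
  obtain ⟨K, hK, hcomp⟩ := friedrichsExtension_exists_isShiftedInverse hdense h hcompact hc
  have hT := friedrichsExtension_isFormalAdjoint hdense h
  have hcT := friedrichsExtension_shiftedCoercive hdense h hc
  refine dense_closure.1 ((hK.dense_domain_sobolev hT).mono fun w hw => ?_)
  obtain ⟨x, hx⟩ := hw.1
  have hxdom := fun n => le_friedrichsExtension hdense h (x n).2
  let v : ℕ → SobolevSpace (friedrichsExtension Ac h) (1 / 2) := fun n =>
    ⟨x n, hK.domain_le_sobolevSubmodule hT hcomp (hxdom n)⟩
  refine mem_closure_of_tendsto (f := v) (b := atTop) ?_ (Eventually.of_forall fun n => (x n).2)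
  rw [tendsto_iff_norm_sub_tendsto_zero, Metric.tendsto_atTop]
  intro ε hε
  have hC : 0 < 2 + |c| := by positivity
  have hδ : 0 < (ε / 2) ^ 2 / (2 + |c|) := by positivity
  have hlim := hx.shifted_tendsto c
  rw [← prod_atTop_atTop_eq] at hlim
  -- The indices are swapped so that $n$ is the outer one and $k$ the inner one in $x_k - x_n$,
  -- matching the approximation of $z = w - x_n$ below.
  have hlim' := hlim.comp ((tendsto_snd (f := atTop) (g := atTop)).prodMk tendsto_fst)
  obtain ⟨N, hN⟩ := eventually_atTop.1 ((hlim'.eventually_lt_const hδ).curry)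
  refine ⟨N, fun n hn => ?_⟩
  let z : (friedrichsExtension Ac h).domain := ⟨w.toH, hw⟩ - ⟨x n, hxdom n⟩
  have hz : FormApprox Ac (fun k => x k - x n) z := hx.sub_const (x n)
  have hle : (inner ℂ (z : H) (friedrichsExtension Ac h z + (c : ℂ) • (z : H))).re
      ≤ (ε / 2) ^ 2 / (2 + |c|) := by
    refine le_of_tendsto (friedrichsExtension_tendsto hdense h hc hz) ?_
    filter_upwards [hN n hn] with k hk
    exact hk.le
  have hnorm := hK.sobolev_norm_sq_le hT hcomp hcT (w - v n) z rfl
  have hsq : ‖w - v n‖ ^ 2 ≤ (ε / 2) ^ 2 := by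
    refine hnorm.trans ((mul_le_mul_of_nonneg_left hle hC.le).trans_eq ?_)
    exact mul_div_cancel₀ _ hC.ne'
  have := le_of_sq_le_sq hsq (by positivity)
  rw [Real.dist_eq, sub_zero, abs_norm, norm_sub_rev]
  linarith

theorem boundaryFunctional_eq_zero_of_mem (hdense : Dense (Ac.domain : Set H))
    (h : IsSemiboundedBelow Ac) (u : (Ac†).domain) (v : (friedrichsExtension Ac h).domain)
    (hv : (v : H) ∈ Ac.domain) : boundaryFunctional Ac (friedrichsExtension Ac h) u v = 0 := by
  change inner ℂ (u : H) (friedrichsExtension Ac h v) - inner ℂ (Ac† u) (v : H) = 0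
  have hle := LinearPMap.IsFormalAdjoint.le_adjoint hdense h.1
  rw [friedrichsExtension_apply, ← hle.2 (x := ⟨v, hv⟩) rfl,
    ← LinearPMap.adjoint_isFormalAdjoint hdense u ⟨v, hv⟩, sub_self]

/-- This is selfadjointness of $A_F$. Solve $(A_F + c)w = (A + c)u$; since $\delta_u = 0$, the
vector $u - w$ is orthogonal to the range of $A_F + c$, which is all of $H$. Taking $v$ with $(A_F +
c)v = u - w$ yields $\|u - w\|^2 = 0$. -/
theorem mem_friedrichsExtension_of_boundaryFunctional_eq_zero
    (hdense : Dense (Ac.domain : Set H)) (h : IsSemiboundedBelow Ac) {u : (Ac†).domain}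
    (hu : boundaryFunctional Ac (friedrichsExtension Ac h) u = 0) :
    (u : H) ∈ (friedrichsExtension Ac h).domain := by
  obtain ⟨c, hc⟩ := h.exists_shiftedCoercive
  obtain ⟨w, hw⟩ := friedrichsExtension_surjective hdense h hc (Ac† u + (c : ℂ) • (u : H))
  obtain ⟨v, hv⟩ := friedrichsExtension_surjective hdense h hc ((u : H) - w)
  have h1 : inner ℂ (u : H) (friedrichsExtension Ac h v) = inner ℂ (Ac† u) (v : H) :=
    sub_eq_zero.1 (LinearMap.congr_fun hu v)
  have h2 := friedrichsExtension_isFormalAdjoint hdense h w v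
  have h3 : inner ℂ ((u : H) - w) ((u : H) - w) = 0 := by
    have h4 : inner ℂ (Ac† u + (c : ℂ) • (u : H)) (v : H)
        = inner ℂ (friedrichsExtension Ac h w + (c : ℂ) • (w : H)) (v : H) := by rw [hw]
    nth_rewrite 2 [← hv]
    simp only [inner_add_left, inner_smul_left, Complex.conj_ofReal] at h4
    rw [inner_sub_left, inner_add_right, inner_add_right, h1, ← h2, inner_smul_right,
      inner_smul_right, h4, sub_self]
  rw [sub_eq_zero.1 (inner_self_eq_zero.1 h3)]
  exact w.2

theorem boundaryFunctional_notMem_negSobolev (hdense : Dense (Ac.domain : Set H))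
    (h : IsSemiboundedBelow Ac) (hcompact : HasCompactDomain (Ac†)) {u : (Ac†).domain}
    (hu : u ∈ boundaryPerp Ac (friedrichsExtension Ac h)) (hu0 : u ≠ 0) :
    boundaryFunctional Ac (friedrichsExtension Ac h) u
      ∉ negSobolev (friedrichsExtension Ac h) (1 / 2) := by
  rintro ⟨ψ, hψ⟩
  obtain ⟨c, hc⟩ := h.exists_shiftedCoercive
  obtain ⟨K, hK, hcomp⟩ := friedrichsExtension_exists_isShiftedInverse hdense h hcompact hc
  have hT := friedrichsExtension_isFormalAdjoint hdense h
  have hψ0 : (ψ : SobolevSpace (friedrichsExtension Ac h) (1 / 2) → ℂ) = fun _ => 0 := by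
    refine Continuous.ext_on (dense_sobolev_friedrichsExtension hdense h hcompact) ψ.continuous
      continuous_const fun w hw => ?_
    have hv := le_friedrichsExtension hdense h hw
    rw [← hψ ⟨w.toH, hv⟩ w rfl]
    exact boundaryFunctional_eq_zero_of_mem hdense h u _ hw
  have hδ : boundaryFunctional Ac (friedrichsExtension Ac h) u = 0 := by
    ext v
    rw [hψ v ⟨v, hK.domain_le_sobolevSubmodule hT hcomp v.2⟩ rfl, hψ0]
    rfl
  -- Now $u \in \mathcal D_F \cap \mathcal E$, so its orthogonality to $D_F$ may be tested on $u$
  -- itself, which makes its graph norm zero.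
  have hself := hu.2 u hu.1 (mem_friedrichsExtension_of_boundaryFunctional_eq_zero hdense h hδ)
  have hre := congrArg Complex.re hself
  have h1 : (inner ℂ (Ac† u) (Ac† u)).re = ‖Ac† u‖ ^ 2 := (norm_sq_eq_re_inner (𝕜 := ℂ) _).symm
  have h2 : (inner ℂ (u : H) (u : H)).re = ‖(u : H)‖ ^ 2 :=
    (norm_sq_eq_re_inner (𝕜 := ℂ) _).symm
  rw [graphInner, Complex.add_re, h1, h2, Complex.zero_re] at hre
  have h3 : ‖(u : H)‖ ^ 2 = 0 := by nlinarith [sq_nonneg ‖Ac† u‖, sq_nonneg ‖(u : H)‖]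
  exact hu0 (Subtype.ext (norm_eq_zero.1 (pow_eq_zero_iff two_ne_zero |>.1 h3)))

end FriedrichsRegularity

theorem proposition4p1 {H : Type*} [NormedAddCommGroup H] [InnerProductSpace ℂ H]
    [CompleteSpace H] [TopologicalSpace.SeparableSpace H]
    (Ac : H →ₗ.[ℂ] H)
    (hdense : Dense (Ac.domain : Set H))
    (hsemi : FriedrichsRegularity.IsSemiboundedBelow Ac)
    (hcompact : FriedrichsRegularity.HasCompactDomain (Ac†))
    (hfin : FiniteDimensional ℂ ((Ac†).domain ⧸ FriedrichsRegularity.minDomainIn Ac))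
    (hpos : 0 < Module.finrank ℂ ((Ac†).domain ⧸ FriedrichsRegularity.minDomainIn Ac)) :
    (FriedrichsRegularity.friedrichsExtension Ac hsemi).domain ≤
        FriedrichsRegularity.sobolevSubmodule
          (FriedrichsRegularity.friedrichsExtension Ac hsemi) (1 / 2) ∧
      FriedrichsRegularity.boundaryFunctionals Ac
          (FriedrichsRegularity.friedrichsExtension Ac hsemi) ∩
        FriedrichsRegularity.negSobolev
          (FriedrichsRegularity.friedrichsExtension Ac hsemi) (1 / 2) = {0} ∧
      (∀ u ∈ FriedrichsRegularity.boundaryPerp Ac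
          (FriedrichsRegularity.friedrichsExtension Ac hsemi), u ≠ 0 →
        FriedrichsRegularity.boundaryFunctional Ac
            (FriedrichsRegularity.friedrichsExtension Ac hsemi) u ∉
          FriedrichsRegularity.negSobolev
            (FriedrichsRegularity.friedrichsExtension Ac hsemi) (1 / 2)) ∧
      FriedrichsRegularity.sobolevClosure Ac
          (FriedrichsRegularity.friedrichsExtension Ac hsemi) (1 / 2) = Set.univ := by
  have hT := FriedrichsRegularity.friedrichsExtension_isFormalAdjoint hdense hsemi
  obtain ⟨c, hc⟩ := hsemi.exists_shiftedCoercive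
  obtain ⟨K, hK, hcomp⟩ :=
    FriedrichsRegularity.friedrichsExtension_exists_isShiftedInverse hdense hsemi hcompact hc
  refine ⟨hK.domain_le_sobolevSubmodule hT hcomp, ?_, fun u hu hu0 =>
    FriedrichsRegularity.boundaryFunctional_notMem_negSobolev hdense hsemi hcompact hu hu0,
    (FriedrichsRegularity.dense_sobolev_friedrichsExtension hdense hsemi hcompact).closure_eq⟩
  have hzero : FriedrichsRegularity.boundaryFunctional Ac
      (FriedrichsRegularity.friedrichsExtension Ac hsemi) 0 = 0 := by
    ext v
    simp [FriedrichsRegularity.boundaryFunctional]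
  -- Zero belongs to the intersection as $\delta_0$, being the restriction of the zero functional on
  -- $H^{1/2}$.
  refine Set.eq_singleton_iff_unique_mem.2 ⟨⟨⟨0, ⟨fun v _ => ?_, fun w _ _ => ?_⟩, hzero⟩,
    ⟨0, fun v w _ => rfl⟩⟩, ?_⟩
  · simp [FriedrichsRegularity.graphInner]
  · simp [FriedrichsRegularity.graphInner]
  · rintro _ ⟨⟨u, hu, rfl⟩, hneg⟩
    by_contra hne
    refine FriedrichsRegularity.boundaryFunctional_notMem_negSobolev hdense hsemi hcompact hu ?_
      hneg
    rintro rfl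
    exact hne hzero
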